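/- Let $S$ be a compact, connected, boundaryless smooth surface, let $d$ be a distance on $S$ inducing its topology (for instance the distance of a Riemannian metric), and let $\lambda$ be the measure on $S$ induced by an area form. Fix a finite atlas of smooth charts $\varphi_i\colon U_i\to\mathbb{R}^2$, $i=1,\dots,k$, that are conservative, i.e. carry $\lambda|_{U_i}$ to the Lebesgue measure on $\varphi_i(U_i)$, and for $x\in S$ put $i(x)=\min\{i : x\in U_i\}$. Let $f\colon S\to S$ be a homeomorphism with $\lambda(f(B))=\lambda(B)$ for all Borel sets $B\subseteq S$. For $x\in S$, $\delta>0$, $n\in\mathbb{N}$ let $$B_x(\delta,n)=\{y\in S : d(f^j(x),f^j(y))<\delta \text{ for } j=0,1,\dots,n\},\qquad \Delta(f,n,x,y)=\frac{\|\varphi_{i(f^n(x))}(f^n(x))-\varphi_{i(f^n(x))}(f^n(y))\|}{\|\varphi_{i(x)}(x)-\varphi_{i(x)}(y)\|},$$ the latter being defined for $y\neq x$ with $y\in U_{i(x)}$ and $f^n(y)\in U_{i(f^n(x))}$. Suprema over $y\in B_x(\delta,n)\setminus\{x\}$ below are taken over those $y$ for which $\Delta(f,n,x,y)$ is defined (for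 fixed $n$ and $x$ and small $\delta$ these are all $y\in B_x(\delta,n)\setminus\{x\}$). The top new Lyapunov exponent of $f$ at $x$ is $$\chi_N^+(f,x)=\limsup_{n\to+\infty}\ \lim_{\delta\to0^+}\ \frac1n\log\sup_{y\in B_x(\delta,n)\setminus\{x\}}\Delta(f,n,x,y)\in[-\infty,+\infty]$$ (the limit in $\delta$ always exists by monotonicity). Suppose that for all sufficiently small $\delta>0$ and all $n\in\mathbb{N}$ the function $g_n^\delta\colon S\to[-\infty,+\infty]$, $$g_n^\delta(x)=\sup_{y\in B_x(\delta,n)\setminus\{x\}}\log\Delta(f,n,x,y),$$ is $\lambda$-integrable, where ``for all sufficiently small $\delta$'' is uniform in $n$. Then for $\lambda$-almost every $x\in S$ $$\chi_N^+(f,x)=\lim_{n\to+\infty}\ \lim_{\delta\to0^+}\ \frac1n\log\sup_{y\in B_x(\delta,n)\setminus\{x\}}\Delta(f,n,x,y)$$ (as a limit in $[-\infty,+\infty]$), and $\chi_N^+(f,x)=\chi_N^+(f,f^m(x))$ for all $m\in\mathbb{Z}$. -/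

import Mathlib

open Set Filter Topology MeasureTheory
open scoped Manifold ContDiff ENNReal

/-- The Euclidean plane. -/
abbrev Plane : Type := EuclideanSpace ℝ (Fin 2)

noncomputable section

section AreaForms

variable (S : Type*) [TopologicalSpace S] [ChartedSpace Plane S]

/-- The coefficient at `y` of a field `α` of alternating bilinear forms on the tangent planes
of `S`, read in the chart `e`: the number `a (y)` such that `α = a du ∧ dv` in the coordinates
`(u, v)` of `e`. -/
def chartCoeff {S : Type*} [TopologicalSpace S] [ChartedSpace Plane S]
    (α : ∀ x : S, TangentSpace (𝓡 2) x [⋀^Fin 2]→ₗ[ℝ] ℝ)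
    (e : OpenPartialHomeomorph S Plane) (y : Plane) : ℝ :=
  α (e.symm y) (fun j : Fin 2 =>
    mfderiv (𝓡 2) (𝓡 2) e.symm y (EuclideanSpace.single j (1 : ℝ) : Plane))

/-- An area form: a smooth nowhere vanishing differential 2-form on the surface `S`. -/
structure AreaForm where
  /-- the alternating bilinear form on each tangent plane -/
  form : ∀ x : S, TangentSpace (𝓡 2) x [⋀^Fin 2]→ₗ[ℝ] ℝ
  smooth : ∀ e ∈ IsManifold.maximalAtlas (𝓡 2) ∞ S,
    ContDiffOn ℝ ∞ (chartCoeff form e) e.target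
  ne_zero : ∀ x : S, form x ≠ 0

end AreaForms

section

variable {S : Type*} [TopologicalSpace S] [ChartedSpace Plane S] [MeasurableSpace S]

/-- `μ` is the measure induced by the area form `α`: in every smooth chart, the measure is
`|a| du dv` where `α = a du ∧ dv`. -/
def AreaForm.Induces (α : AreaForm S) (μ : Measure S) : Prop :=
  ∀ e ∈ IsManifold.maximalAtlas (𝓡 2) ∞ S, ∀ B : Set S, MeasurableSet B → B ⊆ e.source →
    μ B = ∫⁻ y in e '' B, ENNReal.ofReal |chartCoeff α.form e y|

/-- A finite atlas of `S`, with `k` smooth charts, all of them conservative, i.e. carrying the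
measure `μ` on their domains to the Lebesgue measure of the plane. -/
structure ConservativeAtlas (μ : Measure S) (k : ℕ) where
  /-- the charts `φ_i : U_i → ℝ²`, where `U_i` is the source of `chart i` -/
  chart : Fin k → OpenPartialHomeomorph S Plane
  mem_atlas : ∀ i, chart i ∈ IsManifold.maximalAtlas (𝓡 2) ∞ S
  conservative : ∀ i, ∀ B : Set S, MeasurableSet B → B ⊆ (chart i).source →
    volume (chart i '' B) = μ B
  cover : ∀ x : S, {i | x ∈ (chart i).source}.Nonempty

end

namespace ConservativeAtlas

variable {S : Type*} [MetricSpace S] [ChartedSpace Plane S] [MeasurableSpace S]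
  {μ : Measure S} {k : ℕ} (A : ConservativeAtlas μ k)

/-- `i(x)`, the smallest index `i` with `x ∈ U_i`. -/
def index (x : S) : Fin k :=
  (wellFounded_lt : WellFounded ((· < ·) : Fin k → Fin k → Prop)).min
    {i | x ∈ (A.chart i).source} (A.cover x)

/-- `φ_{i(x)}`, the chart used around the point `x`. -/
def chartOf (x : S) : OpenPartialHomeomorph S Plane := A.chart (A.index x)

/-- The dynamical ball `B_x(δ, n)`. -/
def dynBall (f : S → S) (x : S) (δ : ℝ) (n : ℕ) : Set S :=
  {y | ∀ j ≤ n, dist (f^[j] x) (f^[j] y) < δ}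

/-- `Δ(f, n, x, y) = ‖fⁿ(x) - fⁿ(y)‖ / ‖x - y‖`, where the differences of points near `x` are
computed in the chart `φ_{i(x)}` and those of points near `fⁿ(x)` in the chart `φ_{i(fⁿ(x))}`. -/
def Delta (f : S → S) (n : ℕ) (x y : S) : ℝ :=
  ‖A.chartOf (f^[n] x) (f^[n] x) - A.chartOf (f^[n] x) (f^[n] y)‖
    / ‖A.chartOf x x - A.chartOf x y‖

/-- The points `y ∈ B_x(δ, n) \ {x}` for which `Δ(f, n, x, y)` is defined: `y` lies in the domain
of the chart at `x`, and `fⁿ(y)` in the domain of the chart at `fⁿ(x)`. For fixed `f`, `n`, `x`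
and all small `δ > 0`, this is the whole set `B_x(δ, n) \ {x}`. -/
def punctured (f : S → S) (x : S) (δ : ℝ) (n : ℕ) : Set S :=
  {y | y ∈ dynBall f x δ n \ {x} ∧ y ∈ (A.chartOf x).source ∧
    f^[n] y ∈ (A.chartOf (f^[n] x)).source}

/-- `g_n^δ(x) = sup_{y ∈ B_x(δ, n) \ {x}} log Δ(f, n, x, y)`, an extended real number. -/
def g (f : S → S) (δ : ℝ) (n : ℕ) (x : S) : EReal :=
  ⨆ y ∈ A.punctured f x δ n, ((Real.log (A.Delta f n x y) : ℝ) : EReal)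

/-- `(1/n) log sup_{y ∈ B_x(δ, n) \ {x}} Δ(f, n, x, y)`, with the supremum in `[0, ∞]` and the
logarithm in `[-∞, ∞]`. -/
def rateAt (f : S → S) (n : ℕ) (x : S) (δ : ℝ) : EReal :=
  ((1 / (n : ℝ) : ℝ) : EReal) *
    ENNReal.log (⨆ y ∈ A.punctured f x δ n, ENNReal.ofReal (A.Delta f n x y))

/-- `lim_{δ → 0} (1/n) log sup_{y ∈ B_x(δ, n) \ {x}} Δ(f, n, x, y)`. The limit always exists, by
`tendsto_rate` below. -/
def rate (f : S → S) (n : ℕ) (x : S) : EReal :=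
  limUnder (𝓝[>] (0 : ℝ)) (A.rateAt f n x)

theorem monotone_rateAt (f : S → S) (n : ℕ) (x : S) : Monotone (A.rateAt f n x) := by
  intro a b hab
  unfold rateAt
  apply mul_le_mul_of_nonneg_left
  · apply ENNReal.log_monotone
    apply biSup_mono
    rintro y ⟨⟨h1, h2⟩, h3⟩
    exact ⟨⟨fun j hj => (h1 j hj).trans_le hab, h2⟩, h3⟩
  · exact_mod_cast (by positivity : (0 : ℝ) ≤ 1 / (n : ℝ))

theorem tendsto_rate (f : S → S) (n : ℕ) (x : S) :
    Tendsto (A.rateAt f n x) (𝓝[>] (0 : ℝ)) (𝓝 (A.rate f n x)) :=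
  tendsto_nhds_limUnder ⟨_, (A.monotone_rateAt f n x).tendsto_nhdsGT 0⟩

/-- The top new Lyapunov exponent `χ_N⁺(f, x)`, an extended real number. -/
def topExponent (f : S → S) (x : S) : EReal :=
  limsup (fun n : ℕ => A.rate f n x) atTop

end ConservativeAtlas

/-- Integrability of an extended-real-valued function: it is (almost everywhere) measurable and
its absolute value has a finite integral. -/
def IntegrableEReal {X : Type*} [MeasurableSpace X] (h : X → EReal) (μ : Measure X) : Prop :=
  AEMeasurable h μ ∧ ∫⁻ x, (h x).abs ∂μ < ⊤

end

/-! ### Maximal inequality and growth of subadditive sequences. -/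

section Ergodic

/-! In the definition of `Delta` the middle chart cancels, so `Delta` is multiplicative along orbits
and, once `δ` is small, `g` is subadditive (`g_add_le`). Letting `δ → 0` gives a subadditive
sequence `gLim` with values in `[-∞, ∞]`, and `rate` is `gLim / n`. The theorem is then Kingman's
theorem, here needing only an integrable positive part of the first term
(`ae_tendsto_of_subadditive`).

For Kingman, the liminf of `H n / n` does not decrease along `T`, hence is invariant. If `a` exceeds
it, every orbit point starts a block on which `H l - l * a` is negative. Cutting orbits into such
blocks leaves an error, `excess`, whose integral tends to 0 as longer blocks are allowed; the
maximal inequality makes its Birkhoff sums at most `n * c`. So the limsup is at most `a + c`, for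
all `a` above the liminf and all `c > 0`. -/

theorem le_coe_toENNReal (x : EReal) : x ≤ (x.toENNReal : EReal) := by
  rw [EReal.coe_toENNReal_eq_max]
  exact le_max_right _ _

variable {X : Type*}

/-- Greedy covering: a visit to `D` opens a block of length `l` whose sum of `F` pays `c` for each
of its at most `l` visits; off `D`, move one step. The last block may overrun time `n`, hence `n +
M`. -/
theorem mul_birkhoffSum_indicator_le (T : X → X) (F : X → ℝ≥0∞) (c : ℝ≥0∞) (D : Set X) (M : ℕ)
    (hD : ∀ x ∈ D, ∃ l, 1 ≤ l ∧ l ≤ M ∧ l * c ≤ birkhoffSum T F l x) (n : ℕ) (x : X) :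
    c * birkhoffSum T (D.indicator 1) n x ≤ birkhoffSum T F (n + M) x := by
  induction n using Nat.strong_induction_on generalizing x with
  | _ n ih =>
  have hcount : ∀ (m : ℕ) (y : X), birkhoffSum T (D.indicator (1 : X → ℝ≥0∞)) m y ≤ m := by
    intro m y
    refine (Finset.sum_le_card_nsmul (Finset.range m) _ 1 fun i _ => ?_).trans (by simp)
    exact indicator_le_self' (fun _ _ => zero_le) _
  rcases Nat.eq_zero_or_pos n with rfl | hn
  · simp
  by_cases hx : x ∈ D
  · obtain ⟨l, hl1, hlM, hl⟩ := hD x hx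
    rcases le_total n l with hnl | hln
    · calc c * birkhoffSum T (D.indicator 1) n x ≤ c * n := by gcongr; exact hcount n x
        _ ≤ l * c := by rw [mul_comm]; gcongr
        _ ≤ birkhoffSum T F l x := hl
        _ ≤ birkhoffSum T F (n + M) x :=
          Finset.sum_le_sum_of_subset (Finset.range_mono (by omega))
    · obtain ⟨m, rfl⟩ := Nat.exists_eq_add_of_le hln
      rw [birkhoffSum_add, mul_add, add_assoc, birkhoffSum_add]
      refine add_le_add ?_ (ih m (by omega) _)
      refine le_trans ?_ hl
      rw [mul_comm]
      gcongr
      exact hcount l x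
  · obtain ⟨m, rfl⟩ := Nat.exists_eq_add_of_le' hn
    rw [birkhoffSum_succ', indicator_of_notMem hx, zero_add, add_right_comm, birkhoffSum_succ']
    exact (ih m (by omega) _).trans le_add_self

/-- The points where some `H l` with `l ≥ 1` is negative, but none with `l ≤ N`. -/
def lateNegative (H : ℕ → X → EReal) (N : ℕ) : Set X :=
  {x | (∃ l, 1 ≤ l ∧ H l x < 0) ∧ ∀ l, 1 ≤ l → l ≤ N → 0 ≤ H l x}

/-- The part of the positive part of `H 1` that is not controlled by blocks of length at most `N`
on which `H` is negative. -/
noncomputable def excess (H : ℕ → X → EReal) (N : ℕ) (x : X) : ℝ≥0∞ :=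
  (lateNegative H N).indicator (fun y => (H 1 y).toENNReal) x + ((H 1 x).toENNReal - N)

/-- Negative blocks of length at most `N` are skipped for free. A point starting none lies in
`lateNegative`, and its step is paid in full by `excess`. The final stretch of at most `N` steps
costs at most `N` per step beyond `excess`, hence `N * N`. -/
theorem le_birkhoffSum_excess {H : ℕ → X → EReal} {T : X → X} {Y : Set X} (hY : MapsTo T Y Y)
    (hsub : ∀ x ∈ Y, ∀ n m, 1 ≤ n → 1 ≤ m → H (n + m) x ≤ H n x + H m (T^[n] x))
    (hneg : ∀ x ∈ Y, ∃ l, 1 ≤ l ∧ H l x < 0) (N n : ℕ) (hn : 1 ≤ n) (x : X) (hx : x ∈ Y) :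
    H n x ≤ ((birkhoffSum T (excess H N) n x + N * N : ℝ≥0∞) : EReal) := by
  have hpos : ∀ n, 1 ≤ n → ∀ x ∈ Y,
      H n x ≤ ((birkhoffSum T (fun y => (H 1 y).toENNReal) n x : ℝ≥0∞) : EReal) := by
    intro n hn
    induction n, hn using Nat.le_induction with
    | base => intro x hx; simpa using le_coe_toENNReal _
    | succ m hm ih =>
      intro x hx
      rw [birkhoffSum_succ', EReal.coe_ennreal_add, add_comm m 1]
      exact (hsub x hx 1 m le_rfl hm).trans
        (add_le_add (le_coe_toENNReal _) (ih _ (hY hx)))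
  induction n using Nat.strong_induction_on generalizing x with
  | _ n ih =>
  rcases le_or_gt n N with hnN | hnN
  · refine (hpos n hn x hx).trans (EReal.coe_ennreal_le_coe_ennreal_iff.2 ?_)
    calc birkhoffSum T (fun y => (H 1 y).toENNReal) n x
        ≤ ∑ i ∈ Finset.range n, (excess H N (T^[i] x) + N) := by
          refine Finset.sum_le_sum fun i _ => ?_
          exact le_tsub_add.trans (by unfold excess; gcongr; exact le_add_self)
      _ = birkhoffSum T (excess H N) n x + n * N := by
          rw [Finset.sum_add_distrib]; simp [birkhoffSum]
      _ ≤ _ := by gcongr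
  · by_cases hB : ∀ l, 1 ≤ l → l ≤ N → 0 ≤ H l x
    -- Subadditivity is available only for positive lengths, so `n = 1` cannot be split.
    · rcases hn.eq_or_lt with rfl | hn1
      · refine (hpos 1 le_rfl x hx).trans (EReal.coe_ennreal_le_coe_ennreal_iff.2 ?_)
        simp only [birkhoffSum_one]
        have hm : x ∈ lateNegative H N := ⟨hneg x hx, hB⟩
        simp only [excess, indicator_of_mem hm, add_assoc]
        exact le_self_add
      obtain ⟨m, rfl⟩ := Nat.exists_eq_add_of_le' hn
      have hm : x ∈ lateNegative H N := ⟨hneg x hx, hB⟩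
      rw [birkhoffSum_succ', add_assoc, EReal.coe_ennreal_add, add_comm m 1]
      refine (hsub x hx 1 m le_rfl (by omega)).trans
        (add_le_add ?_ (ih m (by omega) (by omega) _ (hY hx)))
      refine (le_coe_toENNReal _).trans (EReal.coe_ennreal_le_coe_ennreal_iff.2 ?_)
      simp only [excess, indicator_of_mem hm]
      exact le_self_add
    · push Not at hB
      obtain ⟨l, hl1, hlN, hl⟩ := hB
      obtain ⟨m, rfl⟩ := Nat.exists_eq_add_of_le (hlN.trans hnN.le)
      calc H (l + m) x ≤ H l x + H m (T^[l] x) := hsub x hx l m hl1 (by omega)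
        _ ≤ 0 + H m (T^[l] x) := by gcongr
        _ = H m (T^[l] x) := zero_add _
        _ ≤ _ := ih m (by omega) (by omega) _ (hY.iterate l hx)
        _ ≤ _ := by
          refine EReal.coe_ennreal_le_coe_ennreal_iff.2 ?_
          rw [birkhoffSum_add]
          gcongr
          exact le_add_self

variable [MeasurableSpace X] {μ : Measure X} {T : X → X}

theorem aemeasurable_birkhoffSum (hT : MeasurePreserving T μ μ) {F : X → ℝ≥0∞}
    (hF : AEMeasurable F μ) (n : ℕ) : AEMeasurable (birkhoffSum T F n) μ :=
  Finset.aemeasurable_fun_sum _ fun i _ =>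
    hF.comp_quasiMeasurePreserving (hT.iterate i).quasiMeasurePreserving

theorem lintegral_birkhoffSum (hT : MeasurePreserving T μ μ) {F : X → ℝ≥0∞}
    (hF : AEMeasurable F μ) (n : ℕ) : ∫⁻ x, birkhoffSum T F n x ∂μ = n * ∫⁻ x, F x ∂μ := by
  have hs := lintegral_finsetSum' (μ := μ) (f := fun i x => F (T^[i] x)) (Finset.range n) fun i _ =>
    hF.comp_quasiMeasurePreserving (hT.iterate i).quasiMeasurePreserving
  simp only [birkhoffSum]
  rw [hs]
  have h : ∀ i, ∫⁻ x, F (T^[i] x) ∂μ = ∫⁻ x, F x ∂μ := fun i =>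
    calc ∫⁻ x, F (T^[i] x) ∂μ = ∫⁻ x, F x ∂(μ.map T^[i]) :=
          (lintegral_map' (by rwa [(hT.iterate i).map_eq]) (hT.iterate i).aemeasurable).symm
      _ = _ := by rw [(hT.iterate i).map_eq]
  simp [h]

/-- The maximal ergodic inequality. -/
theorem mul_measure_exists_le_birkhoffSum_le (hT : MeasurePreserving T μ μ) {F : X → ℝ≥0∞}
    (hF : AEMeasurable F μ) (c : ℝ≥0∞) :
    c * μ {x | ∃ n : ℕ, 1 ≤ n ∧ n * c ≤ birkhoffSum T F n x} ≤ ∫⁻ x, F x ∂μ := by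
  set D : ℕ → Set X := fun M => {x | ∃ n : ℕ, 1 ≤ n ∧ n ≤ M ∧ n * c ≤ birkhoffSum T F n x}
  have hDU : {x | ∃ n : ℕ, 1 ≤ n ∧ n * c ≤ birkhoffSum T F n x} = ⋃ M, D M := by
    ext x
    simp only [mem_ofPred_eq, mem_iUnion, D]
    exact ⟨fun ⟨n, h1, h2⟩ => ⟨n, n, h1, le_rfl, h2⟩, fun ⟨_, n, h1, _, h2⟩ => ⟨n, h1, h2⟩⟩
  have hmono : Monotone D := fun M M' h x ⟨n, h1, h2, h3⟩ => ⟨n, h1, h2.trans h, h3⟩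
  rw [hDU, hmono.measure_iUnion, ENNReal.mul_iSup]
  refine iSup_le fun M => ?_
  have hDm : NullMeasurableSet (D M) μ := by
    have : D M = ⋃ n ∈ {n : ℕ | 1 ≤ n ∧ n ≤ M}, {x | n * c ≤ birkhoffSum T F n x} := by
      ext x; simp [D, and_assoc]
    rw [this]
    exact NullMeasurableSet.biUnion (to_countable _) fun n _ =>
      nullMeasurableSet_le aemeasurable_const (aemeasurable_birkhoffSum hT hF n)
  rcases eq_or_ne (∫⁻ x, F x ∂μ) ⊤ with hI | hI
  · simp [hI]
  have hind : AEMeasurable ((D M).indicator (1 : X → ℝ≥0∞)) μ :=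
    aemeasurable_one.indicator₀ hDm
  -- Integrating the covering bound; after division by `n` the overrun `M` disappears in the limit.
  have hbound : ∀ n : ℕ, n * (c * μ (D M)) ≤ (n + M : ℕ) * ∫⁻ x, F x ∂μ := by
    intro n
    calc n * (c * μ (D M)) = ∫⁻ x, c * birkhoffSum T ((D M).indicator 1) n x ∂μ := by
          rw [lintegral_const_mul'' _ (aemeasurable_birkhoffSum hT hind n),
            lintegral_birkhoffSum hT hind, lintegral_indicator_one₀ hDm]
          ring
      _ ≤ ∫⁻ x, birkhoffSum T F (n + M) x ∂μ :=
          lintegral_mono fun x => mul_birkhoffSum_indicator_le T F c _ M (fun _ h => h) n x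
      _ = _ := lintegral_birkhoffSum hT hF _
  have hlim : Tendsto (fun n : ℕ => ∫⁻ x, F x ∂μ + (M * ∫⁻ x, F x ∂μ) / n) atTop
      (𝓝 (∫⁻ x, F x ∂μ + 0)) := by
    refine tendsto_const_nhds.add ?_
    have := ENNReal.Tendsto.const_div (a := M * ∫⁻ x, F x ∂μ) ENNReal.tendsto_nat_nhds_top
      (Or.inr (by finiteness))
    simpa using this
  rw [add_zero] at hlim
  refine ge_of_tendsto hlim ?_
  filter_upwards [eventually_gt_atTop 0] with n hn
  have hn' : (n : ℝ≥0∞) ≠ 0 := by exact_mod_cast hn.ne'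
  have h := hbound n
  rw [Nat.cast_add, add_mul] at h
  have h2 := ENNReal.div_le_div_right h (n : ℝ≥0∞)
  rwa [ENNReal.add_div, mul_comm (n : ℝ≥0∞), mul_comm (n : ℝ≥0∞),
    ENNReal.mul_div_cancel_right hn' (by simp), ENNReal.mul_div_cancel_right hn' (by simp)] at h2

theorem aemeasurable_excess {H : ℕ → X → EReal} (hH : ∀ n, 1 ≤ n → AEMeasurable (H n) μ) (N : ℕ) :
    AEMeasurable (excess H N) μ := by
  have h1 := (hH 1 le_rfl).ereal_toENNReal
  refine (h1.indicator₀ ?_).add (h1.sub aemeasurable_const)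
  have : lateNegative H N = (⋃ l ∈ {l : ℕ | 1 ≤ l}, {x | H l x < 0}) ∩
      ⋂ l ∈ {l : ℕ | 1 ≤ l ∧ l ≤ N}, {x | 0 ≤ H l x} := by
    ext x; simp [lateNegative]
  rw [this]
  refine NullMeasurableSet.inter ?_ ?_
  · exact NullMeasurableSet.biUnion (to_countable _) fun n hn =>
      nullMeasurableSet_lt (hH n hn) aemeasurable_const
  · exact NullMeasurableSet.biInter (to_countable _) fun n hn =>
      nullMeasurableSet_le aemeasurable_const (hH n hn.1)

/-- Dominated convergence: where `(H 1 x).toENNReal` is finite, `excess H N x` vanishes once `N`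
exceeds it and also the first negative time, if there is one. -/
theorem tendsto_lintegral_excess {H : ℕ → X → EReal} (hH : ∀ n, 1 ≤ n → AEMeasurable (H n) μ)
    (hint : ∫⁻ x, (H 1 x).toENNReal ∂μ ≠ ⊤) :
    Tendsto (fun N => ∫⁻ x, excess H N x ∂μ) atTop (𝓝 0) := by
  have h1 := (hH 1 le_rfl).ereal_toENNReal
  have := tendsto_lintegral_of_dominated_convergence' (μ := μ) (F := fun N => excess H N)
    (f := fun _ => 0) (fun x => 2 * (H 1 x).toENNReal) (aemeasurable_excess hH)
    (fun N => ae_of_all _ fun x => ?_)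
    (by rw [lintegral_const_mul'' _ h1]; finiteness) ?_
  · simpa using this
  · change _ ≤ 2 * _
    rw [two_mul]
    exact add_le_add (indicator_le_self' (fun _ _ => zero_le) _) tsub_le_self
  · filter_upwards [ae_lt_top' h1 hint] with x hx
    have hex : ∀ᶠ N in atTop, excess H N x = 0 := by
      obtain ⟨K, hK⟩ := ENNReal.exists_nat_gt hx.ne
      have hlate : ∀ᶠ N in atTop, x ∉ lateNegative H N := by
        by_cases h : ∃ l, 1 ≤ l ∧ H l x < 0
        · obtain ⟨l, hl1, hl⟩ := h
          filter_upwards [eventually_ge_atTop l] with N hN hmem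
          exact absurd hl (hmem.2 l hl1 hN).not_gt
        · exact Eventually.of_forall fun N hmem => h hmem.1
      filter_upwards [hlate, eventually_ge_atTop K] with N hN hKN
      simp only [excess, indicator_of_notMem hN, zero_add]
      exact tsub_eq_zero_of_le (hK.le.trans (by exact_mod_cast hKN))
    exact tendsto_const_nhds.congr' (hex.mono fun N h => h.symm)

/-- A subadditive sequence of functions grows at most at speed `c > 0` along the orbits on which
every point has a negative block. -/
theorem ae_eventually_le_of_negative_blocks (hT : MeasurePreserving T μ μ)
    {H : ℕ → X → EReal} (hH : ∀ n, 1 ≤ n → AEMeasurable (H n) μ)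
    (hint : ∫⁻ x, (H 1 x).toENNReal ∂μ ≠ ⊤)
    (hsub : ∀ᵐ x ∂μ, ∀ n m, 1 ≤ n → 1 ≤ m → H (n + m) x ≤ H n x + H m (T^[n] x))
    {c : ℝ} (hc : 0 < c) :
    ∀ᵐ x ∂μ, (∀ k : ℕ, ∃ l, 1 ≤ l ∧ H l (T^[k] x) < 0) →
      ∀ᶠ n : ℕ in atTop, H n x ≤ ((n * c : ℝ) : EReal) := by
  -- Half of `c` bounds the Birkhoff sum of `excess`; the other half absorbs `N * N` for large `n`.
  set c' : ℝ≥0∞ := ENNReal.ofReal (c / 2) with hc'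
  have hc'0 : c' ≠ 0 := by simpa [hc'] using hc
  set D : ℕ → Set X := fun N => {x | ∃ n : ℕ, 1 ≤ n ∧ n * c' ≤ birkhoffSum T (excess H N) n x}
  -- By the maximal inequality, `D N` has measure at most the integral of `excess H N` divided by
  -- `c'`.
  have hD : μ (⋂ N, D N) = 0 := by
    have hlim : Tendsto (fun N => (∫⁻ x, excess H N x ∂μ) / c') atTop (𝓝 (0 / c')) :=
      ENNReal.Tendsto.div_const (tendsto_lintegral_excess hH hint) (Or.inr hc'0)
    rw [ENNReal.zero_div] at hlim
    refine le_antisymm (ge_of_tendsto' hlim fun N => ?_) zero_le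
    rw [ENNReal.le_div_iff_mul_le (Or.inl hc'0) (Or.inl ENNReal.ofReal_ne_top), mul_comm]
    refine le_trans ?_ (mul_measure_exists_le_birkhoffSum_le hT (aemeasurable_excess hH N) c')
    gcongr
    exact iInter_subset D N
  have horbit : ∀ᵐ x ∂μ, ∀ k : ℕ, ∀ n m, 1 ≤ n → 1 ≤ m →
      H (n + m) (T^[k] x) ≤ H n (T^[k] x) + H m (T^[n] (T^[k] x)) :=
    ae_all_iff.2 fun k => (hT.iterate k).quasiMeasurePreserving.ae hsub
  filter_upwards [horbit, measure_eq_zero_iff_ae_notMem.1 hD] with x hxsub hxD hneg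
  obtain ⟨N, hN⟩ : ∃ N, x ∉ D N := by simpa using hxD
  obtain ⟨K, hK⟩ := exists_nat_gt (N * N / (c / 2))
  filter_upwards [eventually_ge_atTop (max K 1)] with n hn
  have hn1 : 1 ≤ n := (le_max_right _ _).trans hn
  have hnK : (K : ℝ) ≤ n := by exact_mod_cast (le_max_left _ _).trans hn
  have key := le_birkhoffSum_excess (H := H) (T := T)
    (Y := {y | (∀ k : ℕ, ∀ n m, 1 ≤ n → 1 ≤ m →
      H (n + m) (T^[k] y) ≤ H n (T^[k] y) + H m (T^[n] (T^[k] y))) ∧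
      ∀ k : ℕ, ∃ l, 1 ≤ l ∧ H l (T^[k] y) < 0})
    (fun y hy => ⟨fun k => hy.1 (k + 1), fun k => hy.2 (k + 1)⟩)
    (fun y hy => hy.1 0) (fun y hy => hy.2 0) N n hn1 x ⟨hxsub, hneg⟩
  refine key.trans ?_
  have hlt : birkhoffSum T (excess H N) n x ≤ n * c' := by
    by_contra! h
    exact hN ⟨n, hn1, h.le⟩
  have hreal : (n : ℝ≥0∞) * c' + N * N ≤ ENNReal.ofReal (n * c) := by
    rw [hc', ← ENNReal.ofReal_natCast n, ← ENNReal.ofReal_natCast N,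
      ← ENNReal.ofReal_mul (by positivity), ← ENNReal.ofReal_mul (by positivity),
      ← ENNReal.ofReal_add (by positivity) (by positivity)]
    apply ENNReal.ofReal_le_ofReal
    rw [div_lt_iff₀ (by positivity)] at hK
    nlinarith
  calc ((birkhoffSum T (excess H N) n x + N * N : ℝ≥0∞) : EReal)
      ≤ ((ENNReal.ofReal (n * c) : ℝ≥0∞) : EReal) :=
        EReal.coe_ennreal_le_coe_ennreal_iff.2 ((add_le_add_left hlt _).trans hreal)
    _ = _ := by rw [EReal.coe_ennreal_ofReal, max_eq_left (by positivity)]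

/-- Each superlevel set lies, up to a null set, in its preimage, which has the same finite measure,
so the two agree almost everywhere. Rational levels suffice. -/
theorem ae_eq_comp_of_ae_le_comp [IsFiniteMeasure μ] (hT : MeasurePreserving T μ μ)
    {φ : X → EReal} (hφ : AEMeasurable φ μ) (hle : ∀ᵐ x ∂μ, φ x ≤ φ (T x)) :
    ∀ᵐ x ∂μ, φ x = φ (T x) := by
  have hq : ∀ q : ℚ, ∀ᵐ x ∂μ, ((q : ℝ) : EReal) < φ (T x) → ((q : ℝ) : EReal) < φ x := by
    intro q
    have hm : NullMeasurableSet {x | ((q : ℝ) : EReal) < φ x} μ :=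
      nullMeasurableSet_lt aemeasurable_const hφ
    have h := ae_eq_of_ae_subset_of_measure_ge (μ := μ) (s := {x | ((q : ℝ) : EReal) < φ x})
      (t := T ⁻¹' {x | ((q : ℝ) : EReal) < φ x})
      (by filter_upwards [hle] with x hx hxq using lt_of_lt_of_le hxq hx)
      (hT.measure_preimage hm).le hm (measure_ne_top _ _)
    filter_upwards [h.mem_iff] with x hx using hx.2
  filter_upwards [hle, ae_all_iff.2 hq] with x hx hxq
  refine hx.antisymm (le_of_not_gt fun h => ?_)
  obtain ⟨q, h1, h2⟩ := EReal.lt_iff_exists_rat_btwn.1 h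
  exact (hxq q h2).not_gt h1

end Ergodic

/-! ### Kingman's theorem in the extended reals. -/

section Kingman

theorem EReal.one_div_mul_lt_coe_iff {n : ℕ} (hn : 1 ≤ n) (h : EReal) (b : ℝ) :
    ((1 / (n : ℝ) : ℝ) : EReal) * h < b ↔ h < ((n * b : ℝ) : EReal) := by
  have hn0 : (0 : ℝ) < n := by exact_mod_cast hn
  have hn1 : (0 : ℝ) < 1 / n := by positivity
  induction h with
  | bot => rw [EReal.coe_mul_bot_of_pos hn1]; simp only [EReal.bot_lt_coe]
  | top => rw [EReal.coe_mul_top_of_pos hn1]; simp only [not_top_lt]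
  | coe r =>
    rw [← EReal.coe_mul, EReal.coe_lt_coe_iff, EReal.coe_lt_coe_iff, one_div, inv_mul_lt_iff₀ hn0]

theorem EReal.coe_lt_one_div_mul_iff {n : ℕ} (hn : 1 ≤ n) (h : EReal) (b : ℝ) :
    b < ((1 / (n : ℝ) : ℝ) : EReal) * h ↔ ((n * b : ℝ) : EReal) < h := by
  have hn0 : (0 : ℝ) < n := by exact_mod_cast hn
  have hn1 : (0 : ℝ) < 1 / n := by positivity
  induction h with
  | bot => rw [EReal.coe_mul_bot_of_pos hn1]; simp only [not_lt_bot]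
  | top => rw [EReal.coe_mul_top_of_pos hn1]; simp only [EReal.coe_lt_top]
  | coe r =>
    rw [← EReal.coe_mul, EReal.coe_lt_coe_iff, EReal.coe_lt_coe_iff, one_div, lt_inv_mul_iff₀ hn0]

variable {X : Type*}

/-- The first step costs at most a real constant, which is negligible after division by `n`. -/
theorem liminf_one_div_mul_le_comp {T : X → X} {H : ℕ → X → EReal} {x : X} (hx : H 1 x ≠ ⊤)
    (hsub : ∀ m, 1 ≤ m → H (1 + m) x ≤ H 1 x + H m (T x)) :
    liminf (fun n : ℕ => ((1 / (n : ℝ) : ℝ) : EReal) * H n x) atTop ≤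
      liminf (fun n : ℕ => ((1 / (n : ℝ) : ℝ) : EReal) * H n (T x)) atTop := by
  by_contra! hlt
  obtain ⟨b, hb1, hb2⟩ := EReal.lt_iff_exists_real_btwn.1 hlt
  obtain ⟨b', hbb', hb'⟩ := EReal.lt_iff_exists_real_btwn.1 hb2
  rw [EReal.coe_lt_coe_iff] at hbb'
  have hfreq := frequently_lt_of_liminf_lt (by isBoundedDefault) hb1
  have hev := eventually_lt_of_lt_liminf hb' (by isBoundedDefault)
  obtain ⟨K, hK⟩ : ∃ K : ℝ, H 1 x ≤ K := by
    obtain ⟨K, hK, -⟩ := EReal.lt_iff_exists_real_btwn.1 (lt_top_iff_ne_top.2 hx)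
    exact ⟨K, hK.le⟩
  -- The bounds `(n + 1) * b' < H (1 + n) x ≤ K + n * b` would force `n * (b' - b) < K - b'`.
  obtain ⟨M, hM⟩ := exists_nat_gt ((K - b') / (b' - b))
  obtain ⟨n, hn, hn1, hnM⟩ := (hfreq.and_eventually (((tendsto_add_atTop_nat 1).eventually hev).and
    (eventually_ge_atTop (max M 1)))).exists
  have hnM' : (M : ℝ) ≤ n := by exact_mod_cast (le_max_left _ _).trans hnM
  have hn2 : 1 ≤ n := (le_max_right _ _).trans hnM
  rw [EReal.one_div_mul_lt_coe_iff hn2] at hn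
  rw [EReal.coe_lt_one_div_mul_iff (by omega), add_comm n 1] at hn1
  have h := hn1.trans_le ((hsub n hn2).trans (add_le_add hK hn.le))
  rw [← EReal.coe_add, EReal.coe_lt_coe_iff] at h
  push_cast at h
  rw [div_lt_iff₀ (by linarith)] at hM
  nlinarith

variable [MeasurableSpace X] {μ : Measure X} {T : X → X}

theorem aemeasurable_liminf_atTop {u : ℕ → X → EReal} (hu : ∀ n, AEMeasurable (u n) μ) :
    AEMeasurable (fun x => liminf (fun n => u n x) atTop) μ := by
  simp only [liminf_eq_iSup_iInf_of_nat]
  exact AEMeasurable.iSup fun n => AEMeasurable.biInf _ (to_countable _) fun i _ => hu i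

/-- The subadditive ergodic theorem, for extended real valued functions. -/
theorem ae_tendsto_of_subadditive [IsFiniteMeasure μ] (hT : MeasurePreserving T μ μ)
    {H : ℕ → X → EReal} (hH : ∀ n, 1 ≤ n → AEMeasurable (H n) μ)
    (hint : ∫⁻ x, (H 1 x).toENNReal ∂μ ≠ ⊤)
    (hsub : ∀ᵐ x ∂μ, ∀ n m, 1 ≤ n → 1 ≤ m → H (n + m) x ≤ H n x + H m (T^[n] x)) :
    ∀ᵐ x ∂μ,
      Tendsto (fun n : ℕ => ((1 / (n : ℝ) : ℝ) : EReal) * H n x) atTop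
        (𝓝 (limsup (fun n : ℕ => ((1 / (n : ℝ) : ℝ) : EReal) * H n x) atTop)) ∧
      limsup (fun n : ℕ => ((1 / (n : ℝ) : ℝ) : EReal) * H n x) atTop =
        limsup (fun n : ℕ => ((1 / (n : ℝ) : ℝ) : EReal) * H n (T x)) atTop := by
  set u : ℕ → X → EReal := fun n x => ((1 / (n : ℝ) : ℝ) : EReal) * H n x with hu
  have hum : ∀ n, AEMeasurable (u n) μ := by
    intro n
    -- At `n = 0` the factor `1 / 0` is `0`, so nothing is needed of `H 0`.
    rcases Nat.eq_zero_or_pos n with rfl | hn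
    · simp [hu]
    · exact aemeasurable_const.mul (hH n hn)
  have htop : ∀ᵐ x ∂μ, H 1 x ≠ ⊤ := by
    filter_upwards [ae_lt_top' (hH 1 le_rfl).ereal_toENNReal hint] with x hx
    exact EReal.toENNReal_ne_top_iff.1 hx.ne
  have hinv : ∀ᵐ x ∂μ, liminf (fun n => u n x) atTop = liminf (fun n => u n (T x)) atTop := by
    refine ae_eq_comp_of_ae_le_comp hT (φ := fun x => liminf (fun n => u n x) atTop)
      (aemeasurable_liminf_atTop hum) ?_
    filter_upwards [htop, hsub] with x hx hxs
    exact liminf_one_div_mul_le_comp hx fun m hm => hxs 1 m le_rfl hm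
  have hinv' : ∀ᵐ x ∂μ, ∀ k : ℕ,
      liminf (fun n => u n x) atTop = liminf (fun n => u n (T^[k] x)) atTop := by
    have h : ∀ᵐ x ∂μ, ∀ k : ℕ,
        liminf (fun n => u n (T^[k] x)) atTop = liminf (fun n => u n (T (T^[k] x))) atTop :=
      ae_all_iff.2 fun k => (hT.iterate k).quasiMeasurePreserving.ae hinv
    filter_upwards [h] with x hx k
    induction k with
    | zero => rfl
    | succ k ih => rw [ih, hx k, Function.iterate_succ_apply']
  -- The sequence `H n - n * a` is again subadditive, with first term of integrable positive part
  -- because the measure is finite.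
  have hblocks : ∀ a : ℝ, ∀ c : ℝ, 0 < c → ∀ᵐ x ∂μ,
      (∀ k : ℕ, ∃ l : ℕ, 1 ≤ l ∧ H l (T^[k] x) + ((-(l * a) : ℝ) : EReal) < 0) →
      ∀ᶠ n : ℕ in atTop, H n x + ((-(n * a) : ℝ) : EReal) ≤ ((n * c : ℝ) : EReal) := by
    intro a c hc
    refine ae_eventually_le_of_negative_blocks hT
      (H := fun n x => H n x + ((-(n * a) : ℝ) : EReal))
      (fun n hn => (hH n hn).add aemeasurable_const) ?_ ?_ hc
    · have hle : ∫⁻ x, (H 1 x + ((-((1 : ℕ) * a) : ℝ) : EReal)).toENNReal ∂μ ≤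
          ∫⁻ x, ((H 1 x).toENNReal + ((-((1 : ℕ) * a) : ℝ) : EReal).toENNReal) ∂μ :=
        lintegral_mono fun x => EReal.toENNReal_add_le
      refine ne_top_of_le_ne_top ?_ hle
      rw [lintegral_add_right _ measurable_const, lintegral_const]
      refine ENNReal.add_ne_top.2 ⟨hint, ENNReal.mul_ne_top ?_ (measure_ne_top _ _)⟩
      exact EReal.toENNReal_ne_top_iff.2 (EReal.coe_ne_top _)
    · filter_upwards [hsub] with x hx n m hn hm
      have hcast : ((-((n + m : ℕ) * a) : ℝ) : EReal) =
          ((-(n * a) : ℝ) : EReal) + ((-(m * a) : ℝ) : EReal) := by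
        exact EReal.coe_eq_coe_iff.2 (by push_cast; ring)
      rw [hcast, add_add_add_comm (H n x)]
      exact add_le_add_left (hx n m hn hm) _
  have hshift : ∀ (h : EReal) (r s : ℝ), h + ((-r : ℝ) : EReal) ≤ s ↔ h ≤ ((s + r : ℝ) : EReal) := by
    intro h r s
    induction h with
    | bot => simp
    | top => rw [EReal.top_add_coe]; simp only [top_le_iff, EReal.coe_ne_top]
    | coe t => norm_cast; constructor <;> intro <;> linarith
  have hshift' : ∀ (h : EReal) (r : ℝ), h < r → h + ((-r : ℝ) : EReal) < 0 := by
    intro h r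
    induction h with
    | bot => simp
    | top => simp
    | coe t => norm_cast; intro; linarith
  have hblocksQ : ∀ᵐ x ∂μ, ∀ p : ℚ × {c : ℚ // 0 < c},
      (∀ k : ℕ, ∃ l : ℕ, 1 ≤ l ∧ H l (T^[k] x) + ((-(l * (p.1 : ℝ)) : ℝ) : EReal) < 0) →
      ∀ᶠ n : ℕ in atTop, H n x + ((-(n * (p.1 : ℝ)) : ℝ) : EReal) ≤
        ((n * ((p.2 : ℚ) : ℝ) : ℝ) : EReal) :=
    ae_all_iff.2 fun p => hblocks _ _ (by exact_mod_cast p.2.2)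
  have heq : ∀ᵐ x ∂μ, liminf (fun n => u n x) atTop = limsup (fun n => u n x) atTop := by
    filter_upwards [hinv', hblocksQ] with x hx hxb
    refine (liminf_le_limsup).antisymm ?_
    by_contra! hlt
    obtain ⟨a, ha, ha2⟩ := EReal.lt_iff_exists_rat_btwn.1 hlt
    obtain ⟨b, hab, hb⟩ := EReal.lt_iff_exists_rat_btwn.1 ha2
    have hab' : a < b := by exact_mod_cast hab
    -- Invariance keeps the liminf below `a` at every orbit point, which supplies the blocks. With
    -- `c = b - a` the conclusion is `H n x ≤ n * b`, against `b` being below the limsup.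
    have hev := hxb (a, ⟨b - a, sub_pos.2 hab'⟩) fun k => by
      rw [hx k] at ha
      obtain ⟨l, hl, hl1⟩ := ((frequently_lt_of_liminf_lt (by isBoundedDefault) ha).and_eventually
        (eventually_ge_atTop 1)).exists
      exact ⟨l, hl1, hshift' _ _ ((EReal.one_div_mul_lt_coe_iff hl1 _ _).1 hl)⟩
    have hfr := frequently_lt_of_lt_limsup (by isBoundedDefault) hb
    obtain ⟨n, hn, hn2, hn1⟩ := (hfr.and_eventually (hev.and (eventually_ge_atTop 1))).exists
    rw [EReal.coe_lt_one_div_mul_iff hn1] at hn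
    rw [hshift] at hn2
    have := hn.trans_le hn2
    rw [EReal.coe_lt_coe_iff] at this
    push_cast at this
    nlinarith
  filter_upwards [heq, hT.quasiMeasurePreserving.ae heq, hinv] with x h1 h2 h3
  exact ⟨tendsto_of_liminf_eq_limsup h1 rfl, by rw [← h1, ← h2, h3]⟩

end Kingman

/-! ### Invariance under all integer powers. -/

section Invariance

theorem EReal.toENNReal_le_abs (x : EReal) : x.toENNReal ≤ x.abs := by
  induction x with
  | bot => simp
  | top => simp
  | coe r =>
    rw [EReal.abs_def, EReal.toENNReal_of_ne_top (EReal.coe_ne_top r), EReal.toReal_coe]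
    exact ENNReal.ofReal_le_ofReal (le_abs_self r)

variable {S : Type*} [MetricSpace S] [MeasurableSpace S] {μ : Measure S}

theorem measurePreserving_of_measure_image [BorelSpace S] (f : S ≃ₜ S)
    (hf : ∀ B : Set S, MeasurableSet B → μ (f '' B) = μ B) : MeasurePreserving f μ μ := by
  refine ⟨f.continuous.measurable, Measure.ext fun B hB => ?_⟩
  rw [Measure.map_apply f.continuous.measurable hB, ← hf _ (f.continuous.measurable hB),
    f.image_preimage]

/-- Every integer power preserves `μ`, so almost every point has the one-step equality along its
whole two-sided orbit. -/
theorem ae_forall_zpow_eq [BorelSpace S] {f : S ≃ₜ S} (hf : MeasurePreserving f μ μ)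
    {β : Type*} {φ : S → β} (hφ : ∀ᵐ x ∂μ, φ x = φ (f x)) :
    ∀ᵐ x ∂μ, ∀ m : ℤ, φ x = φ ((f ^ m : S ≃ₜ S) x) := by
  have hinv : MeasurePreserving (f⁻¹ : S ≃ₜ S) μ μ :=
    hf.symm f.toMeasurableEquiv
  have hpow : ∀ m : ℤ, MeasurePreserving (f ^ m : S ≃ₜ S) μ μ := by
    intro m
    induction m with
    | zero => exact MeasurePreserving.id μ
    | succ i ih => rw [zpow_add_one]; exact ih.comp hf
    | pred i ih => rw [zpow_sub_one]; exact ih.comp hinv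
  have hall : ∀ᵐ x ∂μ, ∀ m : ℤ, φ ((f ^ m : S ≃ₜ S) x) = φ (f ((f ^ m : S ≃ₜ S) x)) :=
    ae_all_iff.2 fun m => (hpow m).quasiMeasurePreserving.ae hφ
  filter_upwards [hall] with x hx m
  have hstep : ∀ m : ℤ, f ((f ^ m : S ≃ₜ S) x) = (f ^ (m + 1) : S ≃ₜ S) x := fun m => by
    rw [add_comm, zpow_one_add]; rfl
  induction m with
  | zero => rfl
  | succ i ih => rw [ih, hx, hstep]
  | pred i ih => rw [ih, hx (-i - 1), hstep, sub_add_cancel]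

end Invariance

/-! ### The subadditive sequence on the surface. -/

section Surface

variable {S : Type*} [MetricSpace S] [ChartedSpace Plane S] [MeasurableSpace S]
  {μ : Measure S} {k : ℕ} (A : ConservativeAtlas μ k)

namespace ConservativeAtlas

/-- Conservative charts give each point a neighbourhood with the area of a bounded planar set;
compactness does the rest. -/
theorem isFiniteMeasure (A : ConservativeAtlas μ k) [CompactSpace S] [BorelSpace S] : IsFiniteMeasure μ := by
  have : IsLocallyFiniteMeasure μ := by
    refine ⟨fun x => ?_⟩
    obtain ⟨i, hi⟩ := A.cover x
    have hopen := (A.chart i).isOpen_inter_preimage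
      (Metric.isOpen_ball (x := A.chart i x) (ε := 1))
    refine ⟨_, hopen.mem_nhds ⟨hi, Metric.mem_ball_self one_pos⟩, ?_⟩
    rw [← A.conservative i _ hopen.measurableSet inter_subset_left]
    refine (measure_mono ?_).trans_lt (measure_ball_lt_top (x := A.chart i x) (r := 1))
    rintro _ ⟨y, hy, rfl⟩
    exact hy.2
  infer_instance

theorem mem_source_chartOf (x : S) : x ∈ (A.chartOf x).source :=
  WellFounded.min_mem _ _ (A.cover x)

theorem norm_chartOf_sub_pos {x y : S} (hy : y ∈ (A.chartOf x).source) (hxy : y ≠ x) :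
    0 < ‖A.chartOf x x - A.chartOf x y‖ :=
  norm_pos_iff.2 <| sub_ne_zero.2 fun h =>
    hxy ((A.chartOf x).injOn (A.mem_source_chartOf x) hy h).symm

variable {f : S → S}

theorem Delta_pos (hf : Function.Injective f) {x y : S} {δ : ℝ} {n : ℕ}
    (hy : y ∈ A.punctured f x δ n) : 0 < A.Delta f n x y :=
  div_pos (A.norm_chartOf_sub_pos hy.2.2 fun h => hy.1.2 (hf.iterate n h))
    (A.norm_chartOf_sub_pos hy.2.1 hy.1.2)

/-- The logarithm is an order isomorphism from `[0, ∞]` to `[-∞, ∞]`, so it commutes with suprema,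
including the empty one. Injectivity makes `Delta` positive, avoiding the default value of
`Real.log` at `0`. -/
theorem g_eq_log (hf : Function.Injective f) (δ : ℝ) (n : ℕ) (x : S) :
    A.g f δ n x = ENNReal.log (⨆ y ∈ A.punctured f x δ n, ENNReal.ofReal (A.Delta f n x y)) := by
  rw [← ENNReal.logOrderIso_apply, OrderIso.map_iSup, g]
  congr 1 with y
  rw [OrderIso.map_iSup]
  congr 1 with hy
  rw [ENNReal.logOrderIso_apply, ENNReal.log_ofReal_of_pos (A.Delta_pos hf hy)]

theorem rateAt_eq (hf : Function.Injective f) (n : ℕ) (x : S) (δ : ℝ) :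
    A.rateAt f n x δ = ((1 / (n : ℝ) : ℝ) : EReal) * A.g f δ n x := by
  rw [A.g_eq_log hf, rateAt]

theorem monotone_g (f : S → S) (n : ℕ) (x : S) : Monotone fun δ => A.g f δ n x :=
  fun _ _ hab => biSup_mono fun _ ⟨⟨h1, h2⟩, h3⟩ =>
    ⟨⟨fun j hj => (h1 j hj).trans_le hab, h2⟩, h3⟩

/-- The limit of `g_n^δ(x)` as `δ → 0`. -/
noncomputable def gLim (f : S → S) (n : ℕ) (x : S) : EReal :=
  sInf ((fun δ => A.g f δ n x) '' Ioi 0)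

theorem tendsto_g (f : S → S) (n : ℕ) (x : S) :
    Tendsto (fun δ => A.g f δ n x) (𝓝[>] 0) (𝓝 (A.gLim f n x)) :=
  (A.monotone_g f n x).tendsto_nhdsGT 0

theorem gLim_le (f : S → S) (n : ℕ) (x : S) {δ : ℝ} (hδ : 0 < δ) :
    A.gLim f n x ≤ A.g f δ n x :=
  sInf_le ⟨δ, hδ, rfl⟩

theorem rate_eq (hf : Function.Injective f) {n : ℕ} (hn : 1 ≤ n) (x : S) :
    A.rate f n x = ((1 / (n : ℝ) : ℝ) : EReal) * A.gLim f n x := by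
  refine tendsto_nhds_unique (A.tendsto_rate f n x) ?_
  simp only [funext (A.rateAt_eq hf n x)]
  have h0 : ((1 / (n : ℝ) : ℝ) : EReal) ≠ 0 :=
    EReal.coe_ne_zero.2 (by positivity)
  refine (EReal.continuousAt_mul (p := (((1 / (n : ℝ) : ℝ) : EReal), A.gLim f n x))
    (Or.inl h0) (Or.inl h0)
    (Or.inl (EReal.coe_ne_bot _)) (Or.inl (EReal.coe_ne_top _))).tendsto.comp
    (tendsto_const_nhds.prodMk_nhds (A.tendsto_g f n x))

/-- Chain rule for `Delta`. Smallness of `δ` puts `f^[n] y` in the chart at `f^[n] x`, so that both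
factors are defined. -/
theorem g_add_le (hf : Function.Injective f) (n m : ℕ) (x : S) :
    ∀ᶠ δ in 𝓝[>] (0 : ℝ), A.g f δ (n + m) x ≤ A.g f δ n x + A.g f δ m (f^[n] x) := by
  obtain ⟨r, hr, hball⟩ := Metric.isOpen_iff.1 (A.chartOf (f^[n] x)).open_source _
    (A.mem_source_chartOf (f^[n] x))
  filter_upwards [Ioo_mem_nhdsGT hr] with δ hδ
  refine iSup₂_le fun y ⟨⟨hy1, hy2⟩, hy3, hy4⟩ => ?_
  have hmid : f^[n] y ∈ (A.chartOf (f^[n] x)).source := by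
    refine hball ?_
    rw [Metric.mem_ball, dist_comm]
    exact (hy1 n (Nat.le_add_right n m)).trans hδ.2
  have hiter : ∀ z, f^[m] (f^[n] z) = f^[n + m] z := fun z => by
    rw [add_comm, Function.iterate_add_apply]
  have h1 : y ∈ A.punctured f x δ n :=
    ⟨⟨fun j hj => hy1 j (by omega), hy2⟩, hy3, hmid⟩
  have h2 : f^[n] y ∈ A.punctured f (f^[n] x) δ m := by
    refine ⟨⟨fun j hj => ?_, fun h => hy2 (hf.iterate n h)⟩, hmid, by rwa [hiter, hiter]⟩
    rw [← Function.iterate_add_apply, ← Function.iterate_add_apply]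
    exact hy1 _ (by omega)
  have hprod : A.Delta f (n + m) x y = A.Delta f n x y * A.Delta f m (f^[n] x) (f^[n] y) := by
    have hne := (A.norm_chartOf_sub_pos hmid fun h => hy2 (hf.iterate n h)).ne'
    simp only [Delta, hiter]
    field_simp
  rw [hprod, Real.log_mul (A.Delta_pos hf h1).ne' (A.Delta_pos hf h2).ne', EReal.coe_add]
  exact add_le_add (le_iSup₂_of_le y h1 le_rfl) (le_iSup₂_of_le _ h2 le_rfl)

/-- Excluding `⊤` rules out `⊤ + ⊥`, where addition is discontinuous. -/
theorem gLim_add_le (hf : Function.Injective f) (n m : ℕ) (x : S)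
    (h1 : A.gLim f n x ≠ ⊤) (h2 : A.gLim f m (f^[n] x) ≠ ⊤) :
    A.gLim f (n + m) x ≤ A.gLim f n x + A.gLim f m (f^[n] x) :=
  le_of_tendsto_of_tendsto (A.tendsto_g f (n + m) x)
    ((EReal.continuousAt_add (p := (A.gLim f n x, A.gLim f m (f^[n] x)))
      (Or.inl h1) (Or.inr h2)).tendsto.comp
      ((A.tendsto_g f n x).prodMk_nhds (A.tendsto_g f m (f^[n] x))))
    (A.g_add_le hf n m x)

theorem aemeasurable_gLim {δ₀ : ℝ} (hδ₀ : 0 < δ₀) {n : ℕ}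
    (h : ∀ δ : ℝ, 0 < δ → δ < δ₀ → AEMeasurable (A.g f δ n) μ) :
    AEMeasurable (A.gLim f n) μ := by
  obtain ⟨v, -, hv, hv0⟩ := exists_seq_strictAnti_tendsto' hδ₀
  refine aemeasurable_of_tendsto_metrizable_ae' (f := fun i => A.g f (v i) n)
    (fun i => h _ (hv i).1 (hv i).2) (ae_of_all _ fun x => ?_)
  exact (A.tendsto_g f n x).comp
    (tendsto_nhdsWithin_iff.2 ⟨hv0, Eventually.of_forall fun i => (hv i).1⟩)

end ConservativeAtlas

end Surface

/-! ### The main theorem. -/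

theorem mainTheorem4 {S : Type*} [MetricSpace S] [CompactSpace S] [ConnectedSpace S]
    [ChartedSpace Plane S] [IsManifold (𝓡 2) ∞ S] [MeasurableSpace S] [BorelSpace S]
    (α : AreaForm S) (leb : Measure S) (hleb : α.Induces leb)
    {k : ℕ} (A : ConservativeAtlas leb k)
    (f : S ≃ₜ S) (hf : ∀ B : Set S, MeasurableSet B → leb (f '' B) = leb B)
    (hint : ∃ δ₀ : ℝ, 0 < δ₀ ∧ ∀ δ : ℝ, 0 < δ → δ < δ₀ → ∀ n : ℕ,
      IntegrableEReal (A.g f δ n) leb) :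
    ∀ᵐ x ∂leb,
      Tendsto (fun n : ℕ => A.rate f n x) atTop (𝓝 (A.topExponent f x)) ∧
      ∀ m : ℤ, A.topExponent f x = A.topExponent f ((f ^ m : S ≃ₜ S) x) := by
  obtain ⟨δ₀, hδ₀, hg⟩ := hint
  have := A.isFiniteMeasure
  have hT := measurePreserving_of_measure_image f hf
  -- The limit lies below `g` at `δ₀ / 2`, which controls its positive part only; the value `⊥`
  -- remains possible.
  have hfin : ∀ n, ∫⁻ x, (A.gLim f n x).toENNReal ∂leb ≠ ⊤ := fun n => by
    refine ne_top_of_le_ne_top (hg (δ₀ / 2) (by positivity) (by linarith) n).2.ne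
      (lintegral_mono fun x => ?_)
    exact (EReal.toENNReal_le_toENNReal (A.gLim_le f n x (by positivity))).trans
      (EReal.toENNReal_le_abs _)
  have hmeas : ∀ n, AEMeasurable (A.gLim f n) leb := fun n =>
    A.aemeasurable_gLim hδ₀ fun δ h1 h2 => (hg δ h1 h2 n).1
  have htop : ∀ᵐ x ∂leb, ∀ n, A.gLim f n x ≠ ⊤ := by
    refine ae_all_iff.2 fun n => ?_
    filter_upwards [ae_lt_top' (hmeas n).ereal_toENNReal (hfin n)] with x hx
    exact EReal.toENNReal_ne_top_iff.1 hx.ne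
  have hsub : ∀ᵐ x ∂leb, ∀ n m, 1 ≤ n → 1 ≤ m →
      A.gLim f (n + m) x ≤ A.gLim f n x + A.gLim f m (f^[n] x) := by
    have h2 : ∀ᵐ x ∂leb, ∀ n m, A.gLim f m (f^[n] x) ≠ ⊤ :=
      ae_all_iff.2 fun n => (hT.iterate n).quasiMeasurePreserving.ae htop
    filter_upwards [htop, h2] with x hx hx2 n m _ _
    exact A.gLim_add_le f.injective n m x (hx n) (hx2 n m)
  have hK := ae_tendsto_of_subadditive hT (fun n _ => hmeas n) (hfin 1) hsub
  have hev : ∀ x, (fun n : ℕ => A.rate f n x) =ᶠ[atTop]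
      fun n : ℕ => ((1 / (n : ℝ) : ℝ) : EReal) * A.gLim f n x := fun x => by
    filter_upwards [eventually_ge_atTop 1] with n hn using A.rate_eq f.injective hn x
  have hexp : ∀ x, A.topExponent f x =
      limsup (fun n : ℕ => ((1 / (n : ℝ) : ℝ) : EReal) * A.gLim f n x) atTop :=
    fun x => limsup_congr (hev x)
  have hinv := ae_forall_zpow_eq hT (φ := A.topExponent f)
    (by filter_upwards [hK] with x hx using by rw [hexp, hexp]; exact hx.2)
  filter_upwards [hK, hinv] with x hx hm
  refine ⟨?_, hm⟩
  rw [hexp]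
  exact hx.1.congr' (hev x).symm
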